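/- \textbf{Setting.} $\lambda$-terms are finite and taken modulo renaming of bound variables; $\to$ is one-step $\beta$-reduction, $\to^n$ its $n$-fold composition, and $N$ is a \emph{reduct} of $M$ if $M\to^n N$ for some $n\in\mathbb N$. A \emph{head step} is a step $\lambda x_1\ldots x_n.(\lambda y.P)Q\,N_1\ldots N_m\to_h\lambda x_1\ldots x_n.(P[y:=Q])N_1\ldots N_m$ $(n,m\ge 0)$; a \emph{head normal form (hnf)} is a term $\lambda x_1\ldots x_n.\,y\,M_1\ldots M_m$ $(n,m\ge 0)$, and a term \emph{has an hnf} if it has a reduct that is an hnf (in which case its head reduction ends in an hnf). A redex $(\lambda x.P)Q$ is \emph{simple} if $x$ has at most one free occurrence in $P$ or $Q$ is a $\beta$-normal form. The set of \emph{simple terms} is the largest set $X$ of $\lambda$-terms such that, for every $M\in X$, either $M$ has no hnf, or the head reduction of $M$ to an hnf $\lambda x_1\ldots x_n.\,y\,M_1\ldots M_m$ contracts only simple redexes and $M_1,\ldots,M_m\in X$. The \emph{clocked Böhm tree} $\mathrm{BT}_c(M)$ is the potentially infinite term over variables, abstraction, application and $\bot$, with some subterms annotated by natural numbers, that is defined coinductively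 as follows. If $M$ has no hnf, then $\mathrm{BT}_c(M)=\bot$ (not annotated). If $M$ head reduces in exactly $k$ steps to the hnf $\lambda x_1\ldots x_n.\,y\,M_1\ldots M_m$, then $\mathrm{BT}_c(M)$ is $\lambda x_1\ldots x_n.\,y\,\mathrm{BT}_c(M_1)\ldots\mathrm{BT}_c(M_m)$ with its root annotated by $k$. Positions are finite sequences over $\{0,1,2\}$, where $0$ leads to the body of an abstraction and $1$, $2$ lead to the function and the argument of an application. The annotations of two trees \emph{agree} at a position $p$ of both if the two subterms at $p$ are both not annotated or both annotated with the same number; otherwise they \emph{differ} at $p$. Terms $M$ and $N$ \emph{match eventually} if $\mathrm{BT}_c(M)$ and $\mathrm{BT}_c(N)$ become equal when all annotations are dropped, and there is $\ell\in\mathbb N$ such that their annotations agree at all positions of length at least $\ell$. \textbf{Proposition.} Let $M$ be a simple term and let $N$ be a reduct of $M$. Then $M$ and $N$ match eventually. Moreover, the annotations of $\mathrm{BT}_c(M)$ and $\mathrm{BT}_c(N)$ differ at only finitely many positions, and at no more than $n$ positions whenever $M\to^n N$. -/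

import Mathlib

namespace ClockedBohm

/-- Finite λ-terms modulo renaming of bound variables, in de Bruijn notation:
a free variable is an index pointing beyond all enclosing abstractions. -/
inductive Term : Type
  | var (i : ℕ) : Term
  | lam (M : Term) : Term
  | app (M N : Term) : Term

namespace Term

instance : Inhabited Term := ⟨var 0⟩

/-- Extension of a renaming under a binder. -/
def upr (ξ : ℕ → ℕ) : ℕ → ℕ
  | 0 => 0
  | i + 1 => ξ i + 1

def rename : Term → (ℕ → ℕ) → Term
  | var i, ξ => var (ξ i)
  | lam M, ξ => lam (M.rename (upr ξ))
  | app M N, ξ => app (M.rename ξ) (N.rename ξ)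

/-- Extension of a substitution under a binder. -/
def ups (σ : ℕ → Term) : ℕ → Term
  | 0 => var 0
  | i + 1 => (σ i).rename Nat.succ

/-- Simultaneous capture-avoiding substitution. -/
def subst : Term → (ℕ → Term) → Term
  | var i, σ => σ i
  | lam M, σ => lam (M.subst (ups σ))
  | app M N, σ => app (M.subst σ) (N.subst σ)

/-- The substitution replacing index `0` by `N` and lowering all other indices. -/
def single (N : Term) : ℕ → Term
  | 0 => N
  | i + 1 => var i

/-- The contractum `M[x := N]` of the redex `(λx.M) N`. -/
def inst (M N : Term) : Term := M.subst (single N)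

/-- Number of free occurrences of the variable with index `i`. -/
def occ : Term → ℕ → ℕ
  | var j, i => if j = i then 1 else 0
  | lam M, i => M.occ (i + 1)
  | app M N, i => M.occ i + N.occ i

/-- `λx₁…xₙ. M`. -/
def lams : ℕ → Term → Term
  | 0, M => M
  | n + 1, M => lam (lams n M)

/-- `M N₁ … Nₘ`. -/
def apps (M : Term) (Ns : List Term) : Term := Ns.foldl app M

end Term

open Term

/-- One-step β-reduction. -/
inductive Beta : Term → Term → Prop
  | beta (M N : Term) : Beta (app (lam M) N) (M.inst N)
  | lam {M M' : Term} : Beta M M' → Beta (lam M) (lam M')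
  | appL {M M' : Term} (N : Term) : Beta M M' → Beta (app M N) (app M' N)
  | appR (M : Term) {N N' : Term} : Beta N N' → Beta (app M N) (app M N')

/-- The `n`-fold composition of a relation. -/
def Steps (r : Term → Term → Prop) : ℕ → Term → Term → Prop
  | 0, M, N => M = N
  | n + 1, M, N => ∃ P, r M P ∧ Steps r n P N

/-- `N` is a reduct of `M`. -/
def Reduces (M N : Term) : Prop := ∃ n, Steps Beta n M N

def IsNormal (M : Term) : Prop := ∀ N, ¬ Beta M N

/-- Head normal forms `λx₁…xₙ. y M₁ … Mₘ`. -/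
def IsHnf (M : Term) : Prop := ∃ (n y : ℕ) (Ms : List Term), M = lams n (apps (var y) Ms)

def HasHnf (M : Term) : Prop := ∃ H, Reduces M H ∧ IsHnf H

/-- `M → M'` is a head step contracting the redex `(λ.P) Q`. -/
def HeadStepOf (P Q M M' : Term) : Prop :=
  ∃ (n : ℕ) (Ns : List Term),
    M = lams n (apps (app (lam P) Q) Ns) ∧ M' = lams n (apps (P.inst Q) Ns)

def HeadStep (M M' : Term) : Prop := ∃ P Q, HeadStepOf P Q M M'

/-- The redex `(λ.P) Q` is linear. -/
def LinearRedex (P _Q : Term) : Prop := P.occ 0 ≤ 1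

/-- The redex `(λ.P) Q` is call-by-value. -/
def CbvRedex (_P Q : Term) : Prop := IsNormal Q

/-- The redex `(λ.P) Q` is simple. -/
def SimpleRedex (P Q : Term) : Prop := LinearRedex P Q ∨ CbvRedex P Q

/-- A head step that contracts a simple redex. -/
def SimpleHeadStep (M M' : Term) : Prop := ∃ P Q, SimpleRedex P Q ∧ HeadStepOf P Q M M'

/-- The closure condition in the coinductive definition of simple terms. -/
def SimpleClosed (X : Set Term) : Prop :=
  ∀ M ∈ X, ¬ HasHnf M ∨
    ∃ (k n y : ℕ) (Ms : List Term),
      Steps SimpleHeadStep k M (lams n (apps (var y) Ms)) ∧ ∀ M' ∈ Ms, M' ∈ X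

/-- Simple terms: the largest set satisfying `SimpleClosed`. -/
def Simple (M : Term) : Prop := ∃ X : Set Term, SimpleClosed X ∧ M ∈ X

/-- Symbols of (potentially infinite) λ-terms with `⊥`. -/
inductive Sym : Type
  | var (i : ℕ) : Sym
  | lam : Sym
  | app : Sym
  | bot : Sym

/-- The directions in which a node has children: `0` for the body of an abstraction,
`1` and `2` for the function and the argument of an application. -/
def Sym.dirs : Sym → Set (Fin 3)
  | .var _ => ∅
  | .lam => {0}
  | .app => {1, 2}
  | .bot => ∅

/-- Signature of λ-terms with `⊥` in which every node also carries an element of `A`. -/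
def treeF (A : Type) : PFunctor.{0, 0} := ⟨A × Sym, fun a => {d : Fin 3 // d ∈ a.2.dirs}⟩

/-- Finite and infinite λ-terms with `⊥` (coinductively), each node carrying an element of `A`. -/
abbrev Tree (A : Type) : Type := (treeF A).M

/-- Annotated terms; `none` at a node means that the subterm there is not annotated. -/
abbrev AnnTree : Type := Tree (Option ℕ)

/-- Drop all annotations. -/
def deannotate : AnnTree → Tree Unit :=
  PFunctor.M.corec fun T => ⟨((), T.dest.1.2), T.dest.2⟩

/-- Positions are sequences over `{0, 1, 2}`. -/
abbrev Position : Type := List (Fin 3)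

open Classical in
/-- The subterm at a position, if defined. -/
noncomputable def subtreeAt {A : Type} : Tree A → Position → Option (Tree A)
  | T, [] => some T
  | T, d :: p => if h : d ∈ T.dest.1.2.dirs then subtreeAt (T.dest.2 ⟨d, h⟩) p else none

/-- The set of positions of a tree. -/
def positions {A : Type} (T : Tree A) : Set Position := {p | (subtreeAt T p).isSome}

/-- The annotation at the root, if any. -/
def rootAnn (T : AnnTree) : Option ℕ := T.dest.1.1

/-- `T₁` and `T₂` are related by `R` at the (common) position `p`: the subterms there are both not
annotated, or both annotated with `R`-related numbers. -/
def RelAt (R : ℕ → ℕ → Prop) (p : Position) (T₁ T₂ : AnnTree) : Prop :=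
  ∃ S₁ S₂, subtreeAt T₁ p = some S₁ ∧ subtreeAt T₂ p = some S₂ ∧
    ((rootAnn S₁ = none ∧ rootAnn S₂ = none) ∨
      ∃ k₁ k₂, rootAnn S₁ = some k₁ ∧ rootAnn S₂ = some k₂ ∧ R k₁ k₂)

/-- `R` holds eventually between `T₁` and `T₂`. -/
def RelEventually (R : ℕ → ℕ → Prop) (T₁ T₂ : AnnTree) : Prop :=
  deannotate T₁ = deannotate T₂ ∧
    ∃ l : ℕ, ∀ p ∈ positions T₁, l ≤ p.length → RelAt R p T₁ T₂

/-- The positions at which the annotations of `T₁` and `T₂` differ. -/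
def differingPositions (T₁ T₂ : AnnTree) : Set Position :=
  {p | p ∈ positions T₁ ∪ positions T₂ ∧ ¬ RelAt Eq p T₁ T₂}

/-- States in the generation of a clocked Böhm tree: `eval M` stands for the clocked Böhm tree of
`M`; `inner H` stands for a proper part `λxᵢ…xₙ. y M₁ … Mⱼ` of a head normal form that is already
computed, in which only the `Mᵢ` have still to be replaced by their clocked Böhm trees. -/
inductive State : Type
  | eval (M : Term) : State
  | inner (H : Term) : State

/-- Output the root of `H` with annotation `a`. -/
def emit (a : Option ℕ) : Term → (treeF (Option ℕ)) State
  | .var i => ⟨(a, .var i), fun d => (Set.notMem_empty d.1 d.2).elim⟩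
  | .lam H => ⟨(a, .lam), fun _ => .inner H⟩
  | .app H M => ⟨(a, .app), fun d => if d.1 = 1 then .inner H else .eval M⟩

/-- The length `k` and the result `H` of the head reduction of `M` to head normal form. These exist
uniquely if `M` has a head normal form. -/
noncomputable def headReduction (M : Term) : ℕ × Term :=
  Classical.epsilon fun kH : ℕ × Term => Steps HeadStep kH.1 M kH.2 ∧ IsHnf kH.2

open Classical in
noncomputable def cbtStep : State → (treeF (Option ℕ)) State
  | .eval M =>
      if HasHnf M then emit (some (headReduction M).1) (headReduction M).2
      else ⟨(none, .bot), fun d => (Set.notMem_empty d.1 d.2).elim⟩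
  | .inner H => emit none H

/-- The clocked Böhm tree of `M`: it is `⊥` if `M` has no head normal form; otherwise, if
`M` head reduces in `k` steps to the head normal form `λx₁…xₙ. y M₁ … Mₘ`, it is
`λx₁…xₙ. y T₁ … Tₘ` with root annotation `k`, where `Tᵢ` is the clocked Böhm tree of `Mᵢ`. -/
noncomputable def clockedBohmTree (M : Term) : AnnTree :=
  PFunctor.M.corec cbtStep (.eval M)

/-- `M` matches `N` eventually. -/
def MatchesEventually (M N : Term) : Prop :=
  RelEventually Eq (clockedBohmTree M) (clockedBohmTree N)

end ClockedBohm

/-! Let `M →ⁿ N`. A simple redex `(λ.P) Q` does not multiply steps when it is contracted: either `P`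
uses `Q` at most once, or no step starts inside `Q`. Hence a head step of a simple term projects
over `M →ⁿ N` without making it longer. Either the projected step is again a head step, or the
redex has already been contracted on the way to `N`; in the latter case the projected reduction is
strictly shorter. So if the head reduction of `M` takes `k` steps and that of `N` takes `l < k`
steps, at least `k - l` of the `n` steps are used up before the head normal forms are reached. The
remaining steps take place inside the arguments of these head normal forms and are distributed over
the subtrees, whose roots are compared in the same way. The `n` steps thus form a budget from which
every differing annotation costs at least one. -/

namespace ClockedBohm

namespace Term

theorem upr_comp (ζ ξ : ℕ → ℕ) : upr (ζ ∘ ξ) = upr ζ ∘ upr ξ := by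
  funext i
  cases i <;> rfl

theorem ups_comp_upr (σ : ℕ → Term) (ξ : ℕ → ℕ) : ups (σ ∘ ξ) = ups σ ∘ upr ξ := by
  funext i
  cases i <;> rfl

theorem ups_var : ups var = var := by
  funext i
  cases i <;> rfl

theorem rename_rename (M : Term) (ξ ζ : ℕ → ℕ) : (M.rename ξ).rename ζ = M.rename (ζ ∘ ξ) := by
  induction M generalizing ξ ζ with
  | var i => rfl
  | lam M ih => simp only [rename, ih, upr_comp]
  | app M N ihM ihN => simp only [rename, ihM, ihN]

theorem subst_rename (M : Term) (ξ : ℕ → ℕ) (σ : ℕ → Term) :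
    (M.rename ξ).subst σ = M.subst (σ ∘ ξ) := by
  induction M generalizing ξ σ with
  | var i => rfl
  | lam M ih => simp only [rename, subst, ih, ups_comp_upr]
  | app M N ihM ihN => simp only [rename, subst, ihM, ihN]

theorem ups_rename_comp (ξ : ℕ → ℕ) (σ : ℕ → Term) :
    ups ((rename · ξ) ∘ σ) = (rename · (upr ξ)) ∘ ups σ := by
  funext i
  cases i with
  | zero => rfl
  | succ i => simp only [ups, Function.comp_apply, rename_rename]; rfl

theorem rename_subst (M : Term) (σ : ℕ → Term) (ξ : ℕ → ℕ) :
    (M.subst σ).rename ξ = M.subst ((rename · ξ) ∘ σ) := by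
  induction M generalizing ξ σ with
  | var i => rfl
  | lam M ih => simp only [rename, subst, ih, ups_rename_comp]
  | app M N ihM ihN => simp only [rename, subst, ihM, ihN]

theorem ups_subst_comp (τ σ : ℕ → Term) :
    ups ((subst · τ) ∘ σ) = (subst · (ups τ)) ∘ ups σ := by
  funext i
  cases i with
  | zero => rfl
  | succ i => simp only [ups, Function.comp_apply, rename_subst, subst_rename]; rfl

theorem subst_subst (M : Term) (σ τ : ℕ → Term) :
    (M.subst σ).subst τ = M.subst ((subst · τ) ∘ σ) := by
  induction M generalizing σ τ with
  | var i => rfl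
  | lam M ih => simp only [subst, ih, ups_subst_comp]
  | app M N ihM ihN => simp only [subst, ihM, ihN]

theorem subst_var (M : Term) : M.subst var = M := by
  induction M with
  | var i => rfl
  | lam M ih => simp only [subst, ups_var, ih]
  | app M N ihM ihN => simp only [subst, ihM, ihN]

theorem inst_rename (M N : Term) (ξ : ℕ → ℕ) :
    (M.inst N).rename ξ = (M.rename (upr ξ)).inst (N.rename ξ) := by
  simp only [inst, rename_subst, subst_rename]
  congr 1
  funext i
  cases i <;> rfl

theorem inst_subst (M N : Term) (σ : ℕ → Term) :
    (M.inst N).subst σ = (M.subst (ups σ)).inst (N.subst σ) := by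
  simp only [inst, subst_subst]
  congr 1
  funext i
  cases i with
  | zero => rfl
  | succ i =>
    simp only [Function.comp_apply, ups, subst_rename]
    exact (subst_var (σ i)).symm

theorem apps_concat (M : Term) (Ns : List Term) (N : Term) :
    apps M (Ns ++ [N]) = app (apps M Ns) N := by
  simp only [apps, List.foldl_append, List.foldl_cons, List.foldl_nil]

end Term

open Term

theorem Beta.rename {M M' : Term} (h : Beta M M') (ξ : ℕ → ℕ) :
    Beta (M.rename ξ) (M'.rename ξ) := by
  induction h generalizing ξ with
  | beta M N => rw [inst_rename]; exact .beta _ _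
  | lam _ ih => exact .lam (ih _)
  | appL N _ ih => exact .appL _ (ih _)
  | appR M _ ih => exact .appR _ (ih _)

theorem Beta.subst {M M' : Term} (h : Beta M M') (σ : ℕ → Term) :
    Beta (M.subst σ) (M'.subst σ) := by
  induction h generalizing σ with
  | beta M N => rw [inst_subst]; exact .beta _ _
  | lam _ ih => exact .lam (ih _)
  | appL N _ ih => exact .appL _ (ih _)
  | appR M _ ih => exact .appR _ (ih _)

theorem Steps.mono {r s : Term → Term → Prop} (hrs : r ≤ s) {n : ℕ} {M N : Term}
    (h : Steps r n M N) : Steps s n M N := by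
  induction n generalizing M with
  | zero => exact h
  | succ n ih =>
    obtain ⟨P, hP, h⟩ := h
    exact ⟨P, hrs _ _ hP, ih h⟩

theorem Steps.eq_of_rightUnique {r : Term → Term → Prop} (hr : Relator.RightUnique r) {k l : ℕ}
    {M H K : Term} (hMH : Steps r k M H) (hH : ∀ N, ¬ r H N) (hMK : Steps r l M K)
    (hK : ∀ N, ¬ r K N) : k = l ∧ H = K := by
  induction k generalizing l M with
  | zero =>
    cases hMH
    cases l with
    | zero => exact ⟨rfl, hMK⟩
    | succ l =>
      obtain ⟨P, hP, -⟩ := hMK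
      exact (hH P hP).elim
  | succ k ih =>
    obtain ⟨P, hP, hPH⟩ := hMH
    cases l with
    | zero =>
      cases hMK
      exact (hK P hP).elim
    | succ l =>
      obtain ⟨Q, hQ, hQK⟩ := hMK
      obtain rfl := hr hP hQ
      obtain ⟨rfl, hHK⟩ := ih hPH hQK
      exact ⟨rfl, hHK⟩

/-- `M` β-reduces to `N` in at most `n` steps. Bounds, unlike exact lengths, add up without
bookkeeping when a reduction is projected over a step that may erase parts of it. -/
inductive ReducesWithin : ℕ → Term → Term → Prop
  | refl (n : ℕ) (M : Term) : ReducesWithin n M M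
  | step {n : ℕ} {M P N : Term} : Beta M P → ReducesWithin n P N → ReducesWithin (n + 1) M N

theorem Steps.reducesWithin {n : ℕ} {M N : Term} (h : Steps Beta n M N) :
    ReducesWithin n M N := by
  induction n generalizing M with
  | zero => exact h ▸ .refl 0 _
  | succ n ih =>
    obtain ⟨P, hP, h⟩ := h
    exact .step hP (ih h)

namespace ReducesWithin

theorem mono {m n : ℕ} (hmn : m ≤ n) {M N : Term} (h : ReducesWithin m M N) :
    ReducesWithin n M N := by
  induction h generalizing n with
  | refl => exact .refl n _
  | step hP _ ih =>
    obtain ⟨n, rfl⟩ := Nat.exists_eq_add_of_lt (Nat.lt_of_succ_le hmn)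
    exact .step hP (ih (Nat.le_add_right _ _))

theorem trans {m n : ℕ} {M N P : Term} (h : ReducesWithin m M N) (h' : ReducesWithin n N P) :
    ReducesWithin (m + n) M P := by
  induction h with
  | refl m => exact h'.mono (Nat.le_add_left n m)
  | step hQ _ ih =>
    rw [Nat.succ_add]
    exact .step hQ (ih h')

theorem map {f : Term → Term} (hf : ∀ {M N}, Beta M N → Beta (f M) (f N)) {n : ℕ} {M N : Term}
    (h : ReducesWithin n M N) : ReducesWithin n (f M) (f N) := by
  induction h with
  | refl n => exact .refl n _
  | step hP _ ih => exact .step (hf hP) ih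

theorem lam {n : ℕ} {M M' : Term} (h : ReducesWithin n M M') :
    ReducesWithin n (lam M) (lam M') :=
  h.map .lam

theorem app {m n : ℕ} {M M' N N' : Term} (hM : ReducesWithin m M M')
    (hN : ReducesWithin n N N') : ReducesWithin (m + n) (app M N) (app M' N') :=
  (hM.map (.appL N)).trans (hN.map (.appR M'))

theorem lam_inv {n : ℕ} {M N : Term} (h : ReducesWithin n (.lam M) N) :
    ∃ M', N = .lam M' ∧ ReducesWithin n M M' := by
  generalize hL : Term.lam M = L at h
  induction h generalizing M with
  | refl n => exact ⟨M, hL.symm, .refl n M⟩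
  | step hP _ ih =>
    subst hL
    cases hP with
    | lam hP =>
      obtain ⟨M', rfl, h⟩ := ih rfl
      exact ⟨M', rfl, .step hP h⟩

theorem app_inv {n : ℕ} {M A N : Term} (h : ReducesWithin n (.app M A) N) :
    (∃ a b M' A', a + b = n ∧ N = .app M' A' ∧ ReducesWithin a M M' ∧ ReducesWithin b A A') ∨
      ∃ a b c B A', a + b + c + 1 = n ∧ ReducesWithin a M (.lam B) ∧ ReducesWithin b A A' ∧
        ReducesWithin c (B.inst A') N := by
  generalize hL : Term.app M A = L at h
  induction h generalizing M A with
  | refl n => exact .inl ⟨n, 0, M, A, rfl, hL.symm, .refl n M, .refl 0 A⟩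
  | @step n _ P N hP h ih =>
    subst hL
    cases hP with
    | beta B _ => exact .inr ⟨0, 0, n, B, A, by omega, .refl 0 _, .refl 0 A, h⟩
    | appL _ hM =>
      rcases ih rfl with ⟨a, b, M', A', rfl, rfl, ha, hb⟩ | ⟨a, b, c, B, A', rfl, ha, hb, hc⟩
      · exact .inl ⟨a + 1, b, M', A', by omega, rfl, .step hM ha, hb⟩
      · exact .inr ⟨a + 1, b, c, B, A', by omega, .step hM ha, hb, hc⟩
    | appR _ hA =>
      rcases ih rfl with ⟨a, b, M', A', rfl, rfl, ha, hb⟩ | ⟨a, b, c, B, A', rfl, ha, hb, hc⟩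
      · exact .inl ⟨a, b + 1, M', A', by omega, rfl, ha, .step hA hb⟩
      · exact .inr ⟨a, b + 1, c, B, A', by omega, ha, .step hA hb, hc⟩

theorem eq_of_isNormal {n : ℕ} {M N : Term} (h : ReducesWithin n M N) (hM : IsNormal M) :
    M = N := by
  cases h with
  | refl => rfl
  | step hP _ => exact (hM _ hP).elim

theorem inst_left {n : ℕ} {P P' : Term} (h : ReducesWithin n P P') (Q : Term) :
    ReducesWithin n (P.inst Q) (P'.inst Q) :=
  h.map (f := (Term.inst · Q)) (·.subst _)

theorem subst_right (P : Term) {i n : ℕ} {σ τ : ℕ → Term} (hi : ReducesWithin n (σ i) (τ i))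
    (hne : ∀ j ≠ i, σ j = τ j) : ReducesWithin (P.occ i * n) (P.subst σ) (P.subst τ) := by
  induction P generalizing i σ τ with
  | var j =>
    by_cases hj : j = i
    · subst hj
      simpa only [occ, if_true, Nat.one_mul, Term.subst] using hi
    · simpa only [Term.subst, hne j hj] using .refl _ _
  | lam P ih =>
    refine (ih (i := i + 1) (hi.map (·.rename Nat.succ)) ?_).lam
    rintro (_ | j) hj
    · rfl
    · simp only [ups, hne j fun h => hj (congrArg Nat.succ h)]
  | app P Q ihP ihQ =>
    rw [occ, Nat.add_mul]
    exact (ihP hi hne).app (ihQ hi hne)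

theorem inst_right (P : Term) {n : ℕ} {Q Q' : Term} (h : ReducesWithin n Q Q') :
    ReducesWithin (P.occ 0 * n) (P.inst Q) (P.inst Q') := by
  refine subst_right P (i := 0) h ?_
  rintro (_ | j) hj
  · exact (hj rfl).elim
  · rfl

end ReducesWithin

theorem SimpleRedex.reducesWithin_inst {P Q P' Q' : Term} {a b : ℕ} (hS : SimpleRedex P Q)
    (hP : ReducesWithin a P P') (hQ : ReducesWithin b Q Q') :
    ReducesWithin (a + b) (P.inst Q) (P'.inst Q') := by
  have hPQ : ReducesWithin b (P.inst Q) (P.inst Q') := by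
    rcases hS with hlin | hcbv
    · exact (hQ.inst_right P).mono ((Nat.mul_le_mul_right b hlin).trans_eq (Nat.one_mul b))
    · rw [hQ.eq_of_isNormal hcbv]
      exact .refl b _
  rw [Nat.add_comm]
  exact hPQ.trans (hP.inst_left Q')

theorem HasHnf.of_reducesWithin {n : ℕ} {M N : Term} (h : ReducesWithin n M N)
    (hN : HasHnf N) : HasHnf M := by
  induction h with
  | refl => exact hN
  | step hP _ ih =>
    obtain ⟨H, ⟨m, hm⟩, hH⟩ := ih hN
    exact ⟨H, ⟨m + 1, _, hP, hm⟩, hH⟩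

/-- Head steps outside of abstractions, `(λ.P) Q N₁ … Nₘ → P[Q] N₁ … Nₘ`, that contract a redex
with `S P Q`. -/
inductive WeakHeadStepWith (S : Term → Term → Prop) : Term → Term → Prop
  | beta {P Q : Term} : S P Q → WeakHeadStepWith S (.app (.lam P) Q) (P.inst Q)
  | app {M P : Term} (N : Term) : WeakHeadStepWith S M P →
      WeakHeadStepWith S (.app M N) (.app P N)

/-- Head steps that contract a redex `(λ.P) Q` with `S P Q`, defined by induction so that they can
be compared with β-reductions of the subterms. -/
inductive HeadStepWith (S : Term → Term → Prop) : Term → Term → Prop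
  | weak {M M' : Term} : WeakHeadStepWith S M M' → HeadStepWith S M M'
  | lam {M M' : Term} : HeadStepWith S M M' → HeadStepWith S (.lam M) (.lam M')

section HeadSteps

variable {S : Term → Term → Prop}

theorem weakHeadStepWith_iff {M M' : Term} : WeakHeadStepWith S M M' ↔
    ∃ P Q Ns, S P Q ∧ M = apps (.app (.lam P) Q) Ns ∧ M' = apps (P.inst Q) Ns := by
  constructor
  · intro h
    induction h with
    | beta hS => exact ⟨_, _, [], hS, rfl, rfl⟩
    | app N _ ih =>
      obtain ⟨P, Q, Ns, hS, rfl, rfl⟩ := ih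
      exact ⟨P, Q, Ns ++ [N], hS, (apps_concat _ _ _).symm, (apps_concat _ _ _).symm⟩
  · rintro ⟨P, Q, Ns, hS, rfl, rfl⟩
    induction Ns using List.reverseRecOn with
    | nil => exact .beta hS
    | append_singleton Ns N ih =>
      rw [apps_concat, apps_concat]
      exact .app N ih

theorem headStepWith_iff {M M' : Term} :
    HeadStepWith S M M' ↔ ∃ P Q, S P Q ∧ HeadStepOf P Q M M' := by
  constructor
  · intro h
    induction h with
    | weak h =>
      obtain ⟨P, Q, Ns, hS, rfl, rfl⟩ := weakHeadStepWith_iff.mp h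
      exact ⟨P, Q, hS, 0, Ns, rfl, rfl⟩
    | lam _ ih =>
      obtain ⟨P, Q, hS, n, Ns, rfl, rfl⟩ := ih
      exact ⟨P, Q, hS, n + 1, Ns, rfl, rfl⟩
  · rintro ⟨P, Q, hS, n, Ns, rfl, rfl⟩
    induction n with
    | zero => exact .weak (weakHeadStepWith_iff.mpr ⟨P, Q, Ns, hS, rfl, rfl⟩)
    | succ n ih => exact .lam ih

theorem simpleHeadStep_eq : SimpleHeadStep = HeadStepWith SimpleRedex := by
  funext M M'
  exact propext headStepWith_iff.symm

theorem headStep_eq : HeadStep = HeadStepWith ⊤ := by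
  funext M M'
  simp only [HeadStep, headStepWith_iff, Pi.top_apply, Prop.top_eq_true, true_and]

theorem simpleHeadStep_le_headStep : SimpleHeadStep ≤ HeadStep :=
  fun _ _ ⟨P, Q, _, h⟩ => ⟨P, Q, h⟩

theorem WeakHeadStepWith.beta_step {M M' : Term} (h : WeakHeadStepWith S M M') : Beta M M' := by
  induction h with
  | beta _ => exact .beta _ _
  | app N _ ih => exact .appL N ih

theorem HeadStepWith.beta_step {M M' : Term} (h : HeadStepWith S M M') : Beta M M' := by
  induction h with
  | weak h => exact h.beta_step
  | lam _ ih => exact .lam ih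

theorem headStep_le_beta : HeadStep ≤ Beta := by
  rw [headStep_eq]
  exact fun _ _ h => h.beta_step

theorem WeakHeadStepWith.rightUnique : Relator.RightUnique (WeakHeadStepWith S) := by
  intro M M₁ M₂ h₁ h₂
  induction h₁ generalizing M₂ with
  | beta _ =>
    cases h₂ with
    | beta _ => rfl
    | app _ h => cases h
  | app N h ih =>
    cases h₂ with
    | beta _ => cases h
    | app _ h' => rw [ih h']

theorem HeadStepWith.rightUnique : Relator.RightUnique (HeadStepWith S) := by
  intro M M₁ M₂ h₁ h₂
  induction h₁ generalizing M₂ with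
  | weak h =>
    cases h₂ with
    | weak h' => exact WeakHeadStepWith.rightUnique h h'
    | lam _ => cases h
  | lam _ ih =>
    cases h₂ with
    | weak h => cases h
    | lam h' => rw [ih h']

end HeadSteps

/-- Terms `y M₁ … Mₘ` whose arguments `Mᵢ` satisfy `p`. -/
inductive Neutral (p : Term → Prop) : Term → Prop
  | var (y : ℕ) : Neutral p (.var y)
  | app {H M : Term} : Neutral p H → p M → Neutral p (.app H M)

/-- Head normal forms `λx₁…xₙ. y M₁ … Mₘ` whose arguments `Mᵢ` satisfy `p`, defined by induction
along the states from which a clocked Böhm tree is generated. -/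
inductive HnfWith (p : Term → Prop) : Term → Prop
  | neutral {H : Term} : Neutral p H → HnfWith p H
  | lam {H : Term} : HnfWith p H → HnfWith p (.lam H)

section HeadNormalForms

variable {p : Term → Prop} {H : Term}

theorem neutral_iff :
    Neutral p H ↔ ∃ (y : ℕ) (Ms : List Term), H = apps (.var y) Ms ∧ ∀ M ∈ Ms, p M := by
  constructor
  · intro h
    induction h with
    | var y => exact ⟨y, [], rfl, by simp⟩
    | @app _ M _ hM ih =>
      obtain ⟨y, Ms, rfl, hMs⟩ := ih
      refine ⟨y, Ms ++ [M], (apps_concat _ _ _).symm, ?_⟩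
      simpa [or_imp, forall_and] using ⟨hMs, hM⟩
  · rintro ⟨y, Ms, rfl, hMs⟩
    induction Ms using List.reverseRecOn with
    | nil => exact .var y
    | append_singleton Ms M ih =>
      simp only [List.mem_append, List.mem_singleton, or_imp, forall_and, forall_eq] at hMs
      rw [apps_concat]
      exact .app (ih hMs.1) hMs.2

theorem hnfWith_iff : HnfWith p H ↔
    ∃ (n y : ℕ) (Ms : List Term), H = lams n (apps (.var y) Ms) ∧ ∀ M ∈ Ms, p M := by
  constructor
  · intro h
    induction h with
    | neutral h =>
      obtain ⟨y, Ms, rfl, hMs⟩ := neutral_iff.mp h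
      exact ⟨0, y, Ms, rfl, hMs⟩
    | lam _ ih =>
      obtain ⟨n, y, Ms, rfl, hMs⟩ := ih
      exact ⟨n + 1, y, Ms, rfl, hMs⟩
  · rintro ⟨n, y, Ms, rfl, hMs⟩
    induction n with
    | zero => exact .neutral (neutral_iff.mpr ⟨y, Ms, rfl, hMs⟩)
    | succ n ih => exact .lam ih

theorem HnfWith.isHnf (h : HnfWith p H) : IsHnf H := by
  obtain ⟨n, y, Ms, rfl, -⟩ := hnfWith_iff.mp h
  exact ⟨n, y, Ms, rfl⟩

theorem IsHnf.hnfWith_top (h : IsHnf H) : HnfWith ⊤ H := by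
  obtain ⟨n, y, Ms, rfl⟩ := h
  exact hnfWith_iff.mpr ⟨n, y, Ms, rfl, fun _ _ => trivial⟩

theorem Neutral.not_weakHeadStepWith (h : Neutral p H) (S : Term → Term → Prop) (N : Term) :
    ¬ WeakHeadStepWith S H N := by
  induction h generalizing N with
  | var y => rintro ⟨⟩
  | app h _ ih =>
    rintro (_ | ⟨_, hstep⟩)
    · cases h
    · exact ih _ hstep

theorem HnfWith.not_headStepWith (h : HnfWith p H) (S : Term → Term → Prop) (N : Term) :
    ¬ HeadStepWith S H N := by
  induction h generalizing N with
  | neutral h =>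
    rintro (hstep | _)
    · exact h.not_weakHeadStepWith S N hstep
    · cases h
  | lam _ ih =>
    rintro (hstep | hstep)
    · cases hstep
    · exact ih _ hstep

theorem IsHnf.not_headStep (h : IsHnf H) (N : Term) : ¬ HeadStep H N := by
  rw [headStep_eq]
  exact h.hnfWith_top.not_headStepWith ⊤ N

theorem Neutral.of_reducesWithin (h : Neutral p H) {n : ℕ} {N : Term}
    (hN : ReducesWithin n H N) : Neutral ⊤ N := by
  induction h generalizing n N with
  | var y =>
    cases hN with
    | refl => exact .var y
    | step hP _ => cases hP
  | app _ _ ih =>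
    rcases hN.app_inv with ⟨a, b, H', A', -, rfl, ha, -⟩ | ⟨a, b, c, B, A', -, ha, -⟩
    · exact .app (ih ha) trivial
    · cases ih ha

theorem Neutral.app_inv (h : Neutral p H) {n : ℕ} {A N : Term}
    (hN : ReducesWithin n (.app H A) N) :
    ∃ a b H' A', a + b = n ∧ N = .app H' A' ∧ ReducesWithin a H H' ∧ ReducesWithin b A A' := by
  refine hN.app_inv.resolve_right ?_
  rintro ⟨a, b, c, B, A', -, ha, -⟩
  cases h.of_reducesWithin ha

theorem HnfWith.of_reducesWithin (h : HnfWith p H) {n : ℕ} {N : Term}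
    (hN : ReducesWithin n H N) : HnfWith ⊤ N := by
  induction h generalizing N with
  | neutral h => exact .neutral (h.of_reducesWithin hN)
  | lam _ ih =>
    obtain ⟨N', rfl, hN'⟩ := hN.lam_inv
    exact .lam (ih hN')

end HeadNormalForms

theorem headReduction_eq {k : ℕ} {M H : Term} (h : Steps HeadStep k M H) (hH : IsHnf H) :
    headReduction M = (k, H) := by
  obtain ⟨hsteps, hhnf⟩ : Steps HeadStep (headReduction M).1 M (headReduction M).2 ∧
      IsHnf (headReduction M).2 :=
    Classical.epsilon_spec (p := fun kH : ℕ × Term => Steps HeadStep kH.1 M kH.2 ∧ IsHnf kH.2)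
      ⟨(k, H), h, hH⟩
  have hunique : Relator.RightUnique HeadStep := headStep_eq ▸ HeadStepWith.rightUnique
  obtain ⟨hk, hH⟩ := hsteps.eq_of_rightUnique hunique hhnf.not_headStep h hH.not_headStep
  exact Prod.ext hk hH

theorem Simple.exists_simpleHeadSteps {M : Term} (hM : Simple M) (h : HasHnf M) :
    ∃ k H, Steps SimpleHeadStep k M H ∧ HnfWith Simple H := by
  obtain ⟨X, hX, hMX⟩ := hM
  obtain ⟨k, n, y, Ms, hsteps, hMs⟩ := (hX M hMX).resolve_left (not_not_intro h)
  exact ⟨k, _, hsteps, hnfWith_iff.mpr ⟨n, y, Ms, rfl, fun M' hM' => ⟨X, hX, hMs M' hM'⟩⟩⟩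

theorem WeakHeadStepWith.project {M M' N : Term} {n : ℕ} (h : WeakHeadStepWith SimpleRedex M M')
    (hN : ReducesWithin n M N) :
    (∃ N', WeakHeadStepWith ⊤ N N' ∧ ReducesWithin n M' N') ∨ ∃ m < n, ReducesWithin m M' N := by
  induction h generalizing n N with
  | beta hS =>
    rcases hN.app_inv with ⟨a, b, F, A, rfl, rfl, ha, hb⟩ | ⟨a, b, c, B, A, rfl, ha, hb, hc⟩
    · obtain ⟨P', rfl, hP⟩ := ha.lam_inv
      exact .inl ⟨_, .beta trivial, hS.reducesWithin_inst hP hb⟩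
    · obtain ⟨_, ⟨⟩, hP⟩ := ha.lam_inv
      exact .inr ⟨a + b + c, Nat.lt_succ_self _, (hS.reducesWithin_inst hP hb).trans hc⟩
  | app _ _ ih =>
    rcases hN.app_inv with ⟨a, b, F, A, rfl, rfl, ha, hb⟩ | ⟨a, b, c, B, A, rfl, ha, hb, hc⟩
    · rcases ih ha with ⟨F', hF', h⟩ | ⟨m, hm, h⟩
      · exact .inl ⟨_, .app A hF', h.app hb⟩
      · exact .inr ⟨m + b, Nat.add_lt_add_right hm b, h.app hb⟩
    · rcases ih ha with ⟨_, ⟨⟩, -⟩ | ⟨m, hm, h⟩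
      exact .inr ⟨m + b + (c + 1), by omega, (h.app hb).trans (.step (.beta B A) hc)⟩

theorem HeadStepWith.project {M M' N : Term} {n : ℕ} (h : HeadStepWith SimpleRedex M M')
    (hN : ReducesWithin n M N) :
    (∃ N', HeadStepWith ⊤ N N' ∧ ReducesWithin n M' N') ∨ ∃ m < n, ReducesWithin m M' N := by
  induction h generalizing N with
  | weak h => exact (h.project hN).imp_left fun ⟨N', hN', h⟩ => ⟨N', .weak hN', h⟩
  | lam _ ih =>
    obtain ⟨N₁, rfl, hN₁⟩ := hN.lam_inv
    rcases ih hN₁ with ⟨N', hN', h⟩ | ⟨m, hm, h⟩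
    · exact .inl ⟨_, .lam hN', h.lam⟩
    · exact .inr ⟨m, hm, h.lam⟩

/-- The head steps of `M` that have no counterpart in the head reduction of `N`, `d` in number, are
paid for by the reduction from `M` to `N`. -/
theorem Steps.project_simpleHeadStep {k n : ℕ} {M H N : Term} (h : Steps SimpleHeadStep k M H)
    (hN : ReducesWithin n M N) :
    ∃ k' d m N', k' + d = k ∧ m + d ≤ n ∧ Steps HeadStep k' N N' ∧ ReducesWithin m H N' := by
  induction k generalizing M N n with
  | zero =>
    cases h
    exact ⟨0, 0, n, N, rfl, le_rfl, rfl, hN⟩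
  | succ k ih =>
    obtain ⟨P, hP, h⟩ := h
    rw [simpleHeadStep_eq] at hP
    rcases hP.project hN with ⟨Q, hQ, hPQ⟩ | ⟨l, hl, hPN⟩
    · obtain ⟨k', d, m, N', rfl, hm, hk', hH⟩ := ih h hPQ
      rw [← headStep_eq] at hQ
      exact ⟨k' + 1, d, m, N', by omega, hm, ⟨Q, hQ, hk'⟩, hH⟩
    · obtain ⟨k', d, m, N', rfl, hm, hk', hH⟩ := ih h hPN
      exact ⟨k', d + 1, m, N', rfl, by omega, hk', hH⟩

theorem card_erase_nil_le_sum_card_preimage_cons {α : Type*} [Fintype α] [DecidableEq α]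
    (F : Finset (List α)) :
    (F.erase []).card ≤ ∑ a, (F.preimage (List.cons a) List.cons_injective.injOn).card := by
  have hsub : F.erase [] ⊆ Finset.univ.biUnion fun a =>
      (F.preimage (List.cons a) List.cons_injective.injOn).image (List.cons a) := by
    rintro (_ | ⟨a, p⟩) hp
    · simp at hp
    · simpa using hp
  exact (Finset.card_le_card hsub).trans
    (Finset.card_biUnion_le.trans (Finset.sum_le_sum fun a _ => Finset.card_image_le))

theorem encard_le_of_forall_finset_card_le {α : Type*} {s : Set α} {n : ℕ}
    (h : ∀ F : Finset α, ↑F ⊆ s → F.card ≤ n) : s.encard ≤ n := by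
  by_contra! hlt
  obtain ⟨t, hts, ht⟩ := Set.exists_subset_encard_eq (Order.add_one_le_of_lt hlt)
  have hfin : t.Finite := Set.finite_of_encard_eq_coe (k := n + 1) (mod_cast ht)
  have hcard : hfin.toFinset.card = n + 1 := by
    rw [hfin.encard_eq_coe_toFinset_card] at ht
    exact_mod_cast ht
  have := h hfin.toFinset (by simpa using hts)
  omega

theorem relAt_eq_iff {p : Position} {T₁ T₂ : AnnTree} : RelAt Eq p T₁ T₂ ↔
    ∃ S₁ S₂, subtreeAt T₁ p = some S₁ ∧ subtreeAt T₂ p = some S₂ ∧ rootAnn S₁ = rootAnn S₂ := by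
  refine exists_congr fun S₁ => exists_congr fun S₂ => and_congr_right' (and_congr_right' ?_)
  cases rootAnn S₁ <;> cases rootAnn S₂ <;> simp [eq_comm]

theorem relEventually_of_finite {T₁ T₂ : AnnTree} (h : deannotate T₁ = deannotate T₂)
    (hfin : (differingPositions T₁ T₂).Finite) : RelEventually Eq T₁ T₂ := by
  obtain ⟨l, hl⟩ := (hfin.image List.length).bddAbove
  refine ⟨h, l + 1, fun p hp hlen => ?_⟩
  by_contra hrel
  have : p.length ≤ l := hl ⟨p, ⟨.inl hp, hrel⟩, rfl⟩
  omega

/-- `x` and `y` carry the same symbol, and the budget `n` can be distributed over their children so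
that corresponding ones are related by `R`, with at least one unit to spare if the annotations of
`x` and `y` differ. -/
def BudgetLift {X : Type} (R : ℕ → X → X → Prop) (n : ℕ) (x y : treeF (Option ℕ) X) : Prop :=
  x.1.2 = y.1.2 ∧ ∃ c : Fin 3 → ℕ, ∑ d, c d ≤ n ∧ (x.1.1 ≠ y.1.1 → ∑ d, c d < n) ∧
    ∀ d h₁ h₂, R (c d) (x.2 ⟨d, h₁⟩) (y.2 ⟨d, h₂⟩)

/-- A family of bisimulations, up to annotations, of the coalgebra `f` that generates trees; the
index bounds the number of differing annotations. -/
def IsBudgetedBisimulation {X : Type} (f : X → treeF (Option ℕ) X) (R : ℕ → X → X → Prop) :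
    Prop :=
  ∀ n x y, R n x y → BudgetLift R n (f x) (f y)

section Trees

variable {X : Type} {f : X → treeF (Option ℕ) X} {R : ℕ → X → X → Prop}

theorem dest_deannotate (T : AnnTree) :
    (deannotate T).dest = ⟨((), T.dest.1.2), fun d => deannotate (T.dest.2 d)⟩ :=
  PFunctor.M.dest_corec _ T

theorem dest_deannotate_corec (x : X) : (deannotate (PFunctor.M.corec f x)).dest =
    ⟨((), (f x).1.2), fun d => deannotate (PFunctor.M.corec f ((f x).2 d))⟩ := by
  rw [dest_deannotate, PFunctor.M.dest_corec]
  rfl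

theorem rootAnn_corec (x : X) : rootAnn (PFunctor.M.corec f x) = (f x).1.1 := by
  rw [rootAnn, PFunctor.M.dest_corec]
  rfl

open Classical in
theorem subtreeAt_corec_cons (x : X) (d : Fin 3) (p : Position) :
    subtreeAt (PFunctor.M.corec f x) (d :: p) =
      if h : d ∈ (f x).1.2.dirs then subtreeAt (PFunctor.M.corec f ((f x).2 ⟨d, h⟩)) p
      else none := by
  rw [subtreeAt, PFunctor.M.dest_corec]
  rfl

theorem rootAnn_ne_of_nil_mem_differingPositions {T₁ T₂ : AnnTree}
    (h : [] ∈ differingPositions T₁ T₂) : rootAnn T₁ ≠ rootAnn T₂ :=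
  fun heq =>
    h.2 (relAt_eq_iff.mpr ⟨T₁, T₂, by simp only [subtreeAt], by simp only [subtreeAt], heq⟩)

theorem cons_mem_differingPositions_corec {x y : X} (hsym : (f x).1.2 = (f y).1.2) {d : Fin 3}
    {p : Position}
    (h : d :: p ∈ differingPositions (PFunctor.M.corec f x) (PFunctor.M.corec f y)) :
    ∃ h₁ h₂, p ∈ differingPositions (PFunctor.M.corec f ((f x).2 ⟨d, h₁⟩))
      (PFunctor.M.corec f ((f y).2 ⟨d, h₂⟩)) := by
  by_cases h₁ : d ∈ (f x).1.2.dirs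
  · have h₂ : d ∈ (f y).1.2.dirs := hsym ▸ h₁
    refine ⟨h₁, h₂, ?_⟩
    simpa only [differingPositions, positions, RelAt, Set.mem_ofPred_eq, Set.mem_union,
      subtreeAt_corec_cons, dif_pos h₁, dif_pos h₂] using h
  · have h₂ : d ∉ (f y).1.2.dirs := hsym ▸ h₁
    simp [differingPositions, positions, subtreeAt_corec_cons, h₁, h₂] at h

theorem IsBudgetedBisimulation.deannotate_eq (hR : IsBudgetedBisimulation f R) {n : ℕ} {x y : X}
    (h : R n x y) : deannotate (PFunctor.M.corec f x) = deannotate (PFunctor.M.corec f y) := by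
  refine PFunctor.M.bisim' (fun z : X × X => ∃ n, R n z.1 z.2)
    (fun z => deannotate (PFunctor.M.corec f z.1)) (fun z => deannotate (PFunctor.M.corec f z.2))
    ?_ (x, y) ⟨n, h⟩
  rintro ⟨x, y⟩ ⟨n, h⟩
  obtain ⟨hsym, c, -, -, hc⟩ := hR n x y h
  refine ⟨_, _, fun d => deannotate (PFunctor.M.corec f ((f y).2 ⟨d.1, hsym ▸ d.2⟩)),
    dest_deannotate_corec x, ?_, fun d => ⟨(_, _), ⟨c d.1, hc d.1 d.2 (hsym ▸ d.2)⟩, rfl, rfl⟩⟩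
  rw [dest_deannotate_corec]
  generalize f y = Y at hsym
  obtain ⟨⟨a, s⟩, g⟩ := Y
  cases hsym
  rfl

theorem IsBudgetedBisimulation.card_le (hR : IsBudgetedBisimulation f R) (l : ℕ) {n : ℕ} {x y : X}
    (h : R n x y) (F : Finset Position) (hlen : ∀ p ∈ F, p.length < l)
    (hF : ↑F ⊆ differingPositions (PFunctor.M.corec f x) (PFunctor.M.corec f y)) :
    F.card ≤ n := by
  induction l generalizing n x y F with
  | zero =>
    rw [Finset.eq_empty_of_forall_notMem fun p hp => Nat.not_lt_zero _ (hlen p hp)]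
    exact Nat.zero_le n
  | succ l ih =>
    obtain ⟨hsym, c, hle, hlt, hc⟩ := hR n x y h
    have hchild (d : Fin 3) :
        (F.preimage (List.cons d) List.cons_injective.injOn).card ≤ c d := by
      rcases (F.preimage (List.cons d) List.cons_injective.injOn).eq_empty_or_nonempty with
        hempty | ⟨p, hp⟩
      · simp [hempty]
      · obtain ⟨h₁, h₂, -⟩ :=
          cons_mem_differingPositions_corec hsym (hF (Finset.mem_preimage.mp hp))
        refine ih (hc d h₁ h₂) _ (fun q hq => ?_) fun q hq => ?_
        · exact Nat.lt_of_succ_lt_succ (hlen _ (Finset.mem_preimage.mp hq))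
        · exact (cons_mem_differingPositions_corec hsym (hF (Finset.mem_preimage.mp hq))).2.2
    have herase : (F.erase []).card ≤ ∑ d, c d :=
      (card_erase_nil_le_sum_card_preimage_cons F).trans (Finset.sum_le_sum fun d _ => hchild d)
    by_cases hnil : [] ∈ F
    · have hne : (f x).1.1 ≠ (f y).1.1 := by
        simpa only [rootAnn_corec] using rootAnn_ne_of_nil_mem_differingPositions (hF hnil)
      rw [← Finset.card_erase_add_one hnil]
      exact herase.trans_lt (hlt hne)
    · rw [← Finset.erase_eq_of_notMem hnil]
      exact herase.trans hle

theorem IsBudgetedBisimulation.encard_differingPositions_le (hR : IsBudgetedBisimulation f R)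
    {n : ℕ} {x y : X} (h : R n x y) :
    (differingPositions (PFunctor.M.corec f x) (PFunctor.M.corec f y)).encard ≤ n :=
  encard_le_of_forall_finset_card_le fun F hF =>
    hR.card_le (F.sup List.length + 1) h F
      (fun _ hp => Nat.lt_succ_of_le (Finset.le_sup (f := List.length) hp)) hF

end Trees

/-- The second state arises from the first by at most `n` β-steps, and all terms that the first
state has still to evaluate are simple. -/
inductive StateReducesWithin : ℕ → State → State → Prop
  | eval {n : ℕ} {M N : Term} : Simple M → ReducesWithin n M N →
      StateReducesWithin n (.eval M) (.eval N)
  | inner {n : ℕ} {H K : Term} : HnfWith Simple H → ReducesWithin n H K →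
      StateReducesWithin n (.inner H) (.inner K)

theorem cbtStep_eval_of_steps {k : ℕ} {M H : Term} (h : Steps HeadStep k M H) (hH : IsHnf H) :
    cbtStep (.eval M) = emit (some k) H := by
  have hM : HasHnf M := ⟨H, ⟨k, h.mono headStep_le_beta⟩, hH⟩
  refine (if_pos hM).trans ?_
  rw [headReduction_eq h hH]

theorem cbtStep_eval_of_not_hasHnf {M : Term} (h : ¬ HasHnf M) :
    cbtStep (.eval M) = ⟨(none, .bot), fun d => (Set.notMem_empty d.1 d.2).elim⟩ :=
  if_neg h

theorem HnfWith.budgetLift_emit {m n : ℕ} {H K : Term} (hH : HnfWith Simple H)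
    (hK : ReducesWithin m H K) {a b : Option ℕ} (hmn : m ≤ n) (hab : a ≠ b → m < n) :
    BudgetLift StateReducesWithin n (emit a H) (emit b K) := by
  rcases hH with (_ | ⟨hH, hA⟩) | hH
  · obtain _ | ⟨⟨⟩, -⟩ := hK
    refine ⟨rfl, 0, by simp, fun hne => ?_, fun d hd => (Set.notMem_empty d hd).elim⟩
    simpa using Nat.zero_lt_of_lt (hab hne)
  · obtain ⟨k, l, H', A', rfl, rfl, hk, hl⟩ := hH.app_inv hK
    refine ⟨rfl, ![0, k, l], by simpa [Fin.sum_univ_three] using hmn,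
      fun hne => by simpa [Fin.sum_univ_three] using hab hne, ?_⟩
    rintro d (rfl | rfl) _
    · exact .inner (.neutral hH) hk
    · exact .eval hA hl
  · obtain ⟨K', rfl, hK'⟩ := hK.lam_inv
    refine ⟨rfl, ![m, 0, 0], by simpa [Fin.sum_univ_three] using hmn,
      fun hne => by simpa [Fin.sum_univ_three] using hab hne, ?_⟩
    rintro d rfl _
    exact .inner hH hK'

theorem Simple.budgetLift_cbtStep_eval {n : ℕ} {M N : Term} (hM : Simple M)
    (hN : ReducesWithin n M N) :
    BudgetLift StateReducesWithin n (cbtStep (.eval M)) (cbtStep (.eval N)) := by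
  by_cases hhnf : HasHnf M
  · obtain ⟨k, H, hk, hH⟩ := hM.exists_simpleHeadSteps hhnf
    obtain ⟨k', d, m, K, rfl, hm, hk', hK⟩ := hk.project_simpleHeadStep hN
    rw [cbtStep_eval_of_steps (hk.mono simpleHeadStep_le_headStep) hH.isHnf,
      cbtStep_eval_of_steps hk' (hH.of_reducesWithin hK).isHnf]
    refine hH.budgetLift_emit hK (by omega) fun hne => ?_
    have hd : d ≠ 0 := by
      rintro rfl
      exact hne rfl
    omega
  · rw [cbtStep_eval_of_not_hasHnf hhnf,
      cbtStep_eval_of_not_hasHnf fun h => hhnf (h.of_reducesWithin hN)]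
    exact ⟨rfl, 0, by simp, fun hne => (hne rfl).elim, fun d hd => (Set.notMem_empty d hd).elim⟩

theorem isBudgetedBisimulation_stateReducesWithin :
    IsBudgetedBisimulation cbtStep StateReducesWithin := by
  rintro n _ _ (⟨hM, hN⟩ | ⟨hH, hK⟩)
  · exact hM.budgetLift_cbtStep_eval hN
  · exact hH.budgetLift_emit hK le_rfl fun hne => (hne rfl).elim

theorem Simple.encard_differingPositions_le {n : ℕ} {M N : Term} (hM : Simple M)
    (hN : ReducesWithin n M N) :
    (differingPositions (clockedBohmTree M) (clockedBohmTree N)).encard ≤ n :=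
  isBudgetedBisimulation_stateReducesWithin.encard_differingPositions_le (.eval hM hN)

theorem Simple.deannotate_clockedBohmTree_eq {n : ℕ} {M N : Term} (hM : Simple M)
    (hN : ReducesWithin n M N) :
    deannotate (clockedBohmTree M) = deannotate (clockedBohmTree N) :=
  isBudgetedBisimulation_stateReducesWithin.deannotate_eq (.eval hM hN)

end ClockedBohm

theorem mainTheorem4 (M N : ClockedBohm.Term) (hM : ClockedBohm.Simple M)
    (hMN : ClockedBohm.Reduces M N) :
    ClockedBohm.MatchesEventually M N ∧
      (ClockedBohm.differingPositions
        (ClockedBohm.clockedBohmTree M) (ClockedBohm.clockedBohmTree N)).Finite ∧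
      ∀ n : ℕ, ClockedBohm.Steps ClockedBohm.Beta n M N →
        (ClockedBohm.differingPositions
          (ClockedBohm.clockedBohmTree M) (ClockedBohm.clockedBohmTree N)).ncard ≤ n := by
  have hcard (n : ℕ) (hn : ClockedBohm.Steps ClockedBohm.Beta n M N) :=
    Set.encard_le_coe_iff_finite_ncard_le.mp (hM.encard_differingPositions_le hn.reducesWithin)
  obtain ⟨n, hn⟩ := hMN
  exact ⟨ClockedBohm.relEventually_of_finite
      (hM.deannotate_clockedBohmTree_eq hn.reducesWithin) (hcard n hn).1,
    (hcard n hn).1, fun n hn => (hcard n hn).2⟩
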